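/- Let $H$ be an infinite dimensional complex Hilbert space (not necessarily separable). For a bounded linear operator $T\colon H_1\to H_2$ between complex Hilbert spaces let $m(T)=\inf\{\|Tx\| : x\in H_1,\ \|x\|=1\}$. Call $T$ minimum attaining if $\|Tx_0\|=m(T)$ for some unit vector $x_0\in H_1$, and absolutely minimum attaining if $T|_M$ is minimum attaining for every nonzero closed subspace $M$ of $H_1$. Let $\mathcal{AM}^+(H)$ be the set of all absolutely minimum attaining bounded operators $T\colon H\to H$ that are positive, that is, $T=T^*$ and $\langle Tx,x\rangle\ge 0$ for all $x\in H$. Then $\mathcal{AM}^+(H)$ is closed under addition. Moreover, $\mathcal{AM}^+(H)$ is a proper cone in the real Banach space of bounded self-adjoint operators on $H$: it consists of self-adjoint operators, contains $0$, is closed under addition and under multiplication by nonnegative real scalars, and if both $T$ and $-T$ belong to $\mathcal{AM}^+(H)$, then $T=0$. -/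

import Mathlib

/-- The minimum modulus `m(T) = inf {‖T x‖ : ‖x‖ = 1}` of a bounded linear operator. -/
noncomputable def minModulus {E F : Type*} [NormedAddCommGroup E] [NormedSpace ℂ E]
    [NormedAddCommGroup F] [NormedSpace ℂ F] (T : E →L[ℂ] F) : ℝ :=
  sInf {r : ℝ | ∃ x : E, ‖x‖ = 1 ∧ r = ‖T x‖}

/-- `T` is minimum attaining: `‖T x₀‖ = m(T)` for some unit vector `x₀`. -/
def IsMinAttaining {E F : Type*} [NormedAddCommGroup E] [NormedSpace ℂ E]
    [NormedAddCommGroup F] [NormedSpace ℂ F] (T : E →L[ℂ] F) : Prop :=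
  ∃ x₀ : E, ‖x₀‖ = 1 ∧ ‖T x₀‖ = minModulus T

/-- `T` is absolutely minimum attaining: its restriction to every nonzero closed subspace is
minimum attaining. -/
def IsAbsMinAttaining {E F : Type*} [NormedAddCommGroup E] [NormedSpace ℂ E]
    [NormedAddCommGroup F] [NormedSpace ℂ F] (T : E →L[ℂ] F) : Prop :=
  ∀ M : Submodule ℂ E, IsClosed (M : Set E) → M ≠ ⊥ → IsMinAttaining (T ∘L M.subtypeL)

/-- The set of positive absolutely minimum attaining operators on `H`. -/
def posAbsMinAttaining (H : Type*) [NormedAddCommGroup H] [InnerProductSpace ℂ H] :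
    Set (H →L[ℂ] H) :=
  {T | IsAbsMinAttaining T ∧ T.IsPositive}

/-! A positive `T` is absolutely minimum attaining exactly when it is diagonalizable, its
eigenvalues tend to some `α ≥ 0`, and only finitely many exceed `α`. Stated with quadratic forms
(`IsEssentiallyScalarFromBelow`), this involves only bounds on subspaces of finite codimension.
Intersecting such subspaces makes the condition additive, even for non-commuting operators, so
`mem_posAbsMinAttaining_iff` gives the cone properties. Salience is just antisymmetry of the
operator order.

Sufficiency (`isAbsMinAttaining`) is a compactness argument resting on
`IsMinAttaining.of_lt_on_orthogonal`. Necessity rests on `exists_forall_le`, which forbids diagonal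
families without a least value. -/

open Filter Topology
open scoped InnerProductSpace

/-! ### Minimum modulus and a criterion for attaining it. -/

section MinModulus

variable {E F : Type*} [NormedAddCommGroup E] [NormedAddCommGroup F]

theorem minModulus_nonneg [NormedSpace ℂ E] [NormedSpace ℂ F] (T : E →L[ℂ] F) :
    0 ≤ minModulus T := by
  apply Real.sInf_nonneg
  rintro r ⟨x, -, rfl⟩
  exact norm_nonneg _

theorem minModulus_le [NormedSpace ℂ E] [NormedSpace ℂ F] (T : E →L[ℂ] F) {x : E}
    (hx : ‖x‖ = 1) : minModulus T ≤ ‖T x‖ := by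
  refine csInf_le ⟨0, ?_⟩ ⟨x, hx, rfl⟩
  rintro r ⟨y, -, rfl⟩
  exact norm_nonneg _

theorem minModulus_mul_norm_le [NormedSpace ℂ E] [NormedSpace ℂ F] (T : E →L[ℂ] F) (x : E) :
    minModulus T * ‖x‖ ≤ ‖T x‖ := by
  rcases eq_or_ne x 0 with rfl | hx
  · simp
  have hx' : 0 < ‖x‖ := norm_pos_iff.mpr hx
  have h := minModulus_le T (x := ((‖x‖⁻¹ : ℝ) : ℂ) • x)
    (by simp [norm_smul, hx'.ne'])
  rw [map_smul, norm_smul] at h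
  simp only [Complex.ofReal_inv, norm_inv, Complex.norm_real, norm_norm] at h
  rwa [inv_mul_eq_div, le_div_iff₀ hx'] at h

theorem minModulus_sq_mul_le [NormedSpace ℂ E] [NormedSpace ℂ F] (T : E →L[ℂ] F) (x : E) :
    minModulus T ^ 2 * ‖x‖ ^ 2 ≤ ‖T x‖ ^ 2 := by
  rw [← mul_pow]
  exact pow_le_pow_left₀ (mul_nonneg (minModulus_nonneg T) (norm_nonneg x))
    (minModulus_mul_norm_le T x) 2

theorem exists_seq_norm_tendsto_minModulus [NormedSpace ℂ E] [NormedSpace ℂ F] [Nontrivial E]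
    (T : E →L[ℂ] F) :
    ∃ x : ℕ → E, (∀ n, ‖x n‖ = 1) ∧ Tendsto (fun n ↦ ‖T (x n)‖) atTop (𝓝 (minModulus T)) := by
  obtain ⟨z, hz⟩ := exists_norm_eq E zero_le_one
  obtain ⟨u, -, hu, hmem⟩ := exists_seq_tendsto_sInf
    (S := {r : ℝ | ∃ x : E, ‖x‖ = 1 ∧ r = ‖T x‖}) ⟨_, z, hz, rfl⟩
    ⟨0, by rintro r ⟨y, -, rfl⟩; exact norm_nonneg _⟩
  choose x hx hux using hmem
  exact ⟨x, hx, by simpa only [← hux, minModulus] using hu⟩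

variable [InnerProductSpace ℂ E] [InnerProductSpace ℂ F]

/-- First order condition satisfied by a minimizer of `‖T x‖` on the unit sphere. -/
theorem inner_map_map_eq_of_norm_eq_minModulus [CompleteSpace E] [CompleteSpace F]
    {T : E →L[ℂ] F} {x : E} (hx : ‖x‖ = 1) (hTx : ‖T x‖ = minModulus T) (y : E) :
    ⟪T y, T x⟫_ℂ = (minModulus T ^ 2 : ℝ) * ⟪y, x⟫_ℂ := by
  set A : E →L[ℂ] E := T.adjoint ∘L T with hA
  have hAs : IsSelfAdjoint A := (ContinuousLinearMap.isPositive_adjoint_comp_self T).isSelfAdjoint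
  have hre : ∀ z, A.reApplyInnerSelf z = ‖T z‖ ^ 2 := fun z ↦ by
    rw [ContinuousLinearMap.reApplyInnerSelf_apply, hA, ContinuousLinearMap.comp_apply,
      ContinuousLinearMap.adjoint_inner_left, inner_self_eq_norm_sq]
  have hmin : IsMinOn A.reApplyInnerSelf (Metric.sphere 0 ‖x‖) x := by
    intro z hz
    rw [mem_sphere_zero_iff_norm, hx] at hz
    simp only [Set.mem_ofPred_eq, hre]
    exact pow_le_pow_left₀ (norm_nonneg _) (hTx ▸ minModulus_le T hz) 2
  have h := hAs.eq_smul_self_of_isLocalExtrOn (Or.inl hmin.localize)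
  rw [ContinuousLinearMap.rayleighQuotient, hre, hx, hTx] at h
  rw [← ContinuousLinearMap.adjoint_inner_right]
  change ⟪y, A x⟫_ℂ = _
  rw [h, inner_smul_right]
  simp

/-- An operator which is bounded below by a constant exceeding its minimum modulus on a subspace of
finite codimension is minimum attaining. -/
theorem IsMinAttaining.of_lt_on_orthogonal [CompleteSpace E] [Nontrivial E] (T : E →L[ℂ] F)
    (U : Submodule ℂ E) [FiniteDimensional ℂ U] {c : ℝ} (hc : minModulus T ^ 2 < c)
    (h : ∀ x ∈ Uᗮ, c * ‖x‖ ^ 2 ≤ ‖T x‖ ^ 2) : IsMinAttaining T := by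
  set m := minModulus T with hm
  obtain ⟨x, hx1, hxm⟩ := exists_seq_norm_tendsto_minModulus T
  obtain ⟨u, -, φ, hφ, hu⟩ := tendsto_subseq_of_bounded (x := fun n ↦ U.orthogonalProjectionOnto (x n))
    (Metric.isBounded_closedBall (x := (0 : U)) (r := 1)) (fun n ↦ by
      rw [mem_closedBall_zero_iff, ← hx1 n]
      exact U.norm_orthogonalProjectionOnto_apply_le (x n))
  -- `q` is a nonnegative quadratic form tending to `0` along the minimizing sequence, and it
  -- dominates `(c - m ^ 2) * ‖·‖ ^ 2` on `Uᗮ`. Once the `U`-components converge, the parallelogram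
  -- law makes the `Uᗮ`-components Cauchy.
  set q : E → ℝ := fun z ↦ ‖T z‖ ^ 2 - m ^ 2 * ‖z‖ ^ 2 with hq
  have hq0 : ∀ z, 0 ≤ q z := fun z ↦ sub_nonneg.mpr (minModulus_sq_mul_le T z)
  have hpar : ∀ a b, q (a - b) ≤ 2 * q a + 2 * q b := fun a b ↦ by
    have h1 := parallelogram_law_with_norm ℂ (T a) (T b)
    have h2 := parallelogram_law_with_norm ℂ a b
    have h3 := hq0 (a + b)
    simp only [hq, map_add, map_sub] at h3 ⊢
    linear_combination h3 + h1 - m ^ 2 * h2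
  have hqle : ∀ z, q z ≤ ‖T‖ ^ 2 * ‖z‖ ^ 2 := fun z ↦ by
    have h1 := pow_le_pow_left₀ (norm_nonneg _) (T.le_opNorm z) 2
    have h2 : 0 ≤ m ^ 2 * ‖z‖ ^ 2 := by positivity
    rw [mul_pow] at h1
    simp only [hq]
    linarith
  have hqx : Tendsto (fun n ↦ q (x n)) atTop (𝓝 0) := by
    have := (hxm.pow 2).sub_const (m ^ 2)
    rw [← hm, sub_self] at this
    simpa [hq, hx1] using this
  set p : ℕ → E := fun n ↦ U.orthogonalProjectionOnto (x (φ n)) with hp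
  have hpu : Tendsto p atTop (𝓝 (u : E)) := (continuous_subtype_val.tendsto u).comp hu
  set w : ℕ → E := fun n ↦ x (φ n) - p n with hw
  have hwU : ∀ n, w n ∈ Uᗮ := fun n ↦ U.sub_starProjection_mem_orthogonal _
  have hest : ∀ n k, (c - m ^ 2) * ‖w n - w k‖ ^ 2 ≤
      4 * q (x (φ n)) + 4 * q (x (φ k)) + 2 * ‖T‖ ^ 2 * ‖p n - p k‖ ^ 2 := fun n k ↦ by
    have h1 := h _ (Uᗮ.sub_mem (hwU n) (hwU k))
    have h2 := hpar (x (φ n)) (x (φ k))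
    have h3 := hpar (x (φ n) - x (φ k)) (p n - p k)
    have h4 := hqle (p n - p k)
    have h5 : x (φ n) - x (φ k) - (p n - p k) = w n - w k := by simp only [hw]; abel
    rw [h5] at h3
    have h6 : q (w n - w k) = ‖T (w n - w k)‖ ^ 2 - m ^ 2 * ‖w n - w k‖ ^ 2 := rfl
    linarith
  have hcm : 0 < c - m ^ 2 := sub_pos.mpr hc
  have hwc : CauchySeq w := by
    rw [cauchySeq_iff_tendsto_dist_atTop_0]
    have hlim : Tendsto (fun n : ℕ × ℕ ↦ (4 * q (x (φ n.1)) + 4 * q (x (φ n.2)) +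
        2 * ‖T‖ ^ 2 * ‖p n.1 - p n.2‖ ^ 2) / (c - m ^ 2)) atTop (𝓝 0) := by
      rw [← prod_atTop_atTop_eq]
      have hfst := tendsto_fst (f := (atTop : Filter ℕ)) (g := (atTop : Filter ℕ))
      have hsnd := tendsto_snd (f := (atTop : Filter ℕ)) (g := (atTop : Filter ℕ))
      have hq' := hqx.comp hφ.tendsto_atTop
      have h1 := (hq'.comp hfst).const_mul 4
      have h2 := (hq'.comp hsnd).const_mul 4
      have h3 := ((((hpu.comp hfst).sub (hpu.comp hsnd)).norm).pow 2).const_mul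
        (2 * ‖T‖ ^ 2)
      have h4 := ((h1.add h2).add h3).div_const (c - m ^ 2)
      simpa using h4
    have hsq : Tendsto (fun n : ℕ × ℕ ↦ dist (w n.1) (w n.2) ^ 2) atTop (𝓝 0) := by
      refine squeeze_zero (fun _ ↦ by positivity) (fun n ↦ ?_) hlim
      rw [le_div_iff₀ hcm, dist_eq_norm, mul_comm]
      exact hest n.1 n.2
    simpa [Real.sqrt_sq] using hsq.sqrt
  obtain ⟨w₀, hw₀⟩ := cauchySeq_tendsto_of_complete hwc
  have hlim : Tendsto (fun n ↦ x (φ n)) atTop (𝓝 (w₀ + u)) := by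
    simpa [hw] using hw₀.add hpu
  refine ⟨w₀ + u, tendsto_nhds_unique hlim.norm (by simp [hx1]), ?_⟩
  exact tendsto_nhds_unique ((T.continuous.tendsto _).comp hlim).norm (hxm.comp hφ.tendsto_atTop)

end MinModulus

/-! ### The quadratic form condition and its sufficiency. -/

section EssentiallyScalar

variable {H : Type*} [NormedAddCommGroup H] [InnerProductSpace ℂ H]

/-- The quadratic form of `T` is at most `α` on a subspace of finite codimension, and for every
`ε > 0` it is at least `α - ε` on a subspace of finite codimension. -/
def IsEssentiallyScalarFromBelow (T : H →L[ℂ] H) (α : ℝ) : Prop :=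
  (∃ s : Set H, s.Finite ∧ ∀ x, (∀ v ∈ s, ⟪v, x⟫_ℂ = 0) → (⟪T x, x⟫_ℂ).re ≤ α * ‖x‖ ^ 2) ∧
  ∀ ε : ℝ, 0 < ε → ∃ s : Set H, s.Finite ∧
    ∀ x, (∀ v ∈ s, ⟪v, x⟫_ℂ = 0) → (α - ε) * ‖x‖ ^ 2 ≤ (⟪T x, x⟫_ℂ).re

namespace IsEssentiallyScalarFromBelow

theorem zero : IsEssentiallyScalarFromBelow (0 : H →L[ℂ] H) 0 := by
  refine ⟨⟨∅, Set.finite_empty, fun x _ ↦ by simp⟩, fun ε hε ↦ ⟨∅, Set.finite_empty, fun x _ ↦ ?_⟩⟩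
  simpa using mul_nonneg hε.le (sq_nonneg ‖x‖)

theorem add {T₁ T₂ : H →L[ℂ] H} {α₁ α₂ : ℝ} (h₁ : IsEssentiallyScalarFromBelow T₁ α₁)
    (h₂ : IsEssentiallyScalarFromBelow T₂ α₂) :
    IsEssentiallyScalarFromBelow (T₁ + T₂) (α₁ + α₂) := by
  obtain ⟨⟨s₁, hs₁, hu₁⟩, hl₁⟩ := h₁
  obtain ⟨⟨s₂, hs₂, hu₂⟩, hl₂⟩ := h₂
  refine ⟨⟨s₁ ∪ s₂, hs₁.union hs₂, fun x hx ↦ ?_⟩, fun ε hε ↦ ?_⟩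
  · have h1 := hu₁ x fun v hv ↦ hx v (Or.inl hv)
    have h2 := hu₂ x fun v hv ↦ hx v (Or.inr hv)
    simp only [add_apply, inner_add_left, Complex.add_re]
    linarith
  · obtain ⟨t₁, ht₁, hb₁⟩ := hl₁ (ε / 2) (half_pos hε)
    obtain ⟨t₂, ht₂, hb₂⟩ := hl₂ (ε / 2) (half_pos hε)
    refine ⟨t₁ ∪ t₂, ht₁.union ht₂, fun x hx ↦ ?_⟩
    have h1 := hb₁ x fun v hv ↦ hx v (Or.inl hv)
    have h2 := hb₂ x fun v hv ↦ hx v (Or.inr hv)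
    simp only [add_apply, inner_add_left, Complex.add_re]
    linarith

theorem smul {T : H →L[ℂ] H} {α : ℝ} (h : IsEssentiallyScalarFromBelow T α) {c : ℝ} (hc : 0 < c) :
    IsEssentiallyScalarFromBelow (c • T) (c * α) := by
  obtain ⟨⟨s, hs, hu⟩, hl⟩ := h
  have hre : ∀ x, (⟪(c • T) x, x⟫_ℂ).re = c * (⟪T x, x⟫_ℂ).re := fun x ↦ by
    rw [smul_apply, ← Complex.coe_smul, inner_smul_left, Complex.conj_ofReal,
      Complex.re_ofReal_mul]
  refine ⟨⟨s, hs, fun x hx ↦ ?_⟩, fun ε hε ↦ ?_⟩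
  · rw [hre, mul_assoc]
    exact mul_le_mul_of_nonneg_left (hu x hx) hc.le
  · obtain ⟨t, ht, hb⟩ := hl (ε / c) (div_pos hε hc)
    refine ⟨t, ht, fun x hx ↦ ?_⟩
    rw [hre]
    calc (c * α - ε) * ‖x‖ ^ 2 = c * ((α - ε / c) * ‖x‖ ^ 2) := by field_simp
      _ ≤ _ := mul_le_mul_of_nonneg_left (hb x hx) hc.le

variable [CompleteSpace H]

/-- `‖T x‖² - α² ‖x‖²` is the quadratic form of `T - α` at `√(T + α) x`. -/
theorem _root_.ContinuousLinearMap.IsPositive.exists_norm_sq_sub_eq {T : H →L[ℂ] H}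
    (hT : T.IsPositive) {α : ℝ} (hα : 0 ≤ α) :
    ∃ R : H →L[ℂ] H, IsSelfAdjoint R ∧
      ∀ x, ‖T x‖ ^ 2 - α ^ 2 * ‖x‖ ^ 2 = (⟪T (R x), R x⟫_ℂ).re - α * ‖R x‖ ^ 2 := by
  set B : H →L[ℂ] H := T + (α : ℂ) • 1 with hB
  have hB0 : 0 ≤ B := by
    rw [ContinuousLinearMap.nonneg_iff_isPositive]
    exact hT.add (ContinuousLinearMap.isPositive_one.smul_of_nonneg (by exact_mod_cast hα))
  set R := CFC.sqrt B with hR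
  have hRs : IsSelfAdjoint R := (CFC.sqrt_nonneg B).isSelfAdjoint
  have hRR : R * R = B := CFC.sqrt_mul_sqrt_self B hB0
  have hsym := hRs.isSymmetric
  refine ⟨R, hRs, fun x ↦ ?_⟩
  have hRRx : ∀ y, R (R y) = T y + (α : ℂ) • y := fun y ↦ by
    rw [← mul_apply_eq_comp, hRR, hB]; simp
  -- `T = R ^ 2 - α` commutes with `R`.
  have hTR : T (R x) = R (T x) := by
    have h1 := hRRx (R x)
    rw [hRRx x, map_add, map_smul] at h1
    exact (add_right_cancel h1).symm
  have h1 : ⟪R (T x), R x⟫_ℂ = ⟪T x, T x⟫_ℂ + α * ⟪T x, x⟫_ℂ := by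
    rw [hsym.apply_clm, hRRx, inner_add_right, inner_smul_right]
  have h2 : ⟪R x, R x⟫_ℂ = ⟪T x, x⟫_ℂ + α * ⟪x, x⟫_ℂ := by
    rw [← hsym.apply_clm, hRRx, inner_add_left, inner_smul_left, Complex.conj_ofReal]
  have h3 : ‖R x‖ ^ 2 = (⟪T x, x⟫_ℂ).re + α * ‖x‖ ^ 2 := by
    rw [← inner_self_eq_norm_sq (𝕜 := ℂ), h2, ← inner_self_eq_norm_sq (𝕜 := ℂ) x]
    simp
  rw [hTR, h1, h3, ← inner_self_eq_norm_sq (𝕜 := ℂ) (T x)]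
  simp
  ring

/-- Since `R` is self-adjoint, `x ⊥ R '' s` gives `R x ⊥ s`, so finite codimension survives the
passage from the form of `T` to that of `T ^ 2`. -/
theorem exists_norm_sq_le {T : H →L[ℂ] H} {α : ℝ} (h : IsEssentiallyScalarFromBelow T α)
    (hT : T.IsPositive) (hα : 0 ≤ α) :
    ∃ s : Set H, s.Finite ∧ ∀ x, (∀ v ∈ s, ⟪v, x⟫_ℂ = 0) → ‖T x‖ ^ 2 ≤ α ^ 2 * ‖x‖ ^ 2 := by
  obtain ⟨R, hR, hTR⟩ := hT.exists_norm_sq_sub_eq hα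
  obtain ⟨s, hs, hu⟩ := h.1
  refine ⟨R '' s, hs.image R, fun x hx ↦ ?_⟩
  have h1 := hu (R x) fun v hv ↦ by
    rw [← hR.isSymmetric.apply_clm]
    exact hx _ ⟨v, hv, rfl⟩
  linarith [hTR x]

theorem exists_le_norm_sq {T : H →L[ℂ] H} {α : ℝ} (h : IsEssentiallyScalarFromBelow T α)
    (hT : T.IsPositive) (hα : 0 ≤ α) {c : ℝ} (hc : c < α ^ 2) :
    ∃ s : Set H, s.Finite ∧ ∀ x, (∀ v ∈ s, ⟪v, x⟫_ℂ = 0) → c * ‖x‖ ^ 2 ≤ ‖T x‖ ^ 2 := by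
  obtain ⟨R, hR, hTR⟩ := hT.exists_norm_sq_sub_eq hα
  -- The `+ 1` keeps `K` positive when `R = 0`.
  set K := ‖R‖ ^ 2 + 1 with hK
  have hK0 : 0 < K := by positivity
  have hε : 0 < (α ^ 2 - c) / K := div_pos (sub_pos.mpr hc) hK0
  obtain ⟨s, hs, hu⟩ := h.2 _ hε
  refine ⟨R '' s, hs.image R, fun x hx ↦ ?_⟩
  have h1 := hu (R x) fun v hv ↦ by
    rw [← hR.isSymmetric.apply_clm]
    exact hx _ ⟨v, hv, rfl⟩
  have h2 : ‖R x‖ ^ 2 ≤ K * ‖x‖ ^ 2 := by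
    have := pow_le_pow_left₀ (norm_nonneg _) (R.le_opNorm x) 2
    rw [mul_pow] at this
    nlinarith [sq_nonneg ‖x‖]
  have h3 : (α ^ 2 - c) / K * ‖R x‖ ^ 2 ≤ (α ^ 2 - c) * ‖x‖ ^ 2 := by
    calc _ ≤ (α ^ 2 - c) / K * (K * ‖x‖ ^ 2) := mul_le_mul_of_nonneg_left h2 hε.le
      _ = _ := by field_simp
  linarith [hTR x]

/-- A nonzero vector of `M` orthogonal to `s` shows `m ≤ α` for the minimum modulus `m` on `M`. If
`m = α`, that vector, normalized, is a minimizer; if `m < α`, the gap feeds the finite codimension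
criterion. -/
theorem isAbsMinAttaining {T : H →L[ℂ] H} {α : ℝ} (h : IsEssentiallyScalarFromBelow T α)
    (hT : T.IsPositive) (hα : 0 ≤ α) : IsAbsMinAttaining T := by
  intro M hM hM0
  have : CompleteSpace M := hM.completeSpace_coe
  have : Nontrivial M := Submodule.nontrivial_iff_ne_bot.mpr hM0
  set S := T ∘L M.subtypeL with hS
  have key : ∀ s : Set H, s.Finite → ∀ c : ℝ, minModulus S ^ 2 < c →
      (∀ x ∈ M, (∀ v ∈ s, ⟪v, x⟫_ℂ = 0) → c * ‖x‖ ^ 2 ≤ ‖T x‖ ^ 2) → IsMinAttaining S := by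
    intro s hs c hc hsc
    have hfin : (M.orthogonalProjectionOnto '' s).Finite := hs.image _
    have := FiniteDimensional.span_of_finite ℂ hfin
    refine IsMinAttaining.of_lt_on_orthogonal S
      (Submodule.span ℂ (M.orthogonalProjectionOnto '' s)) hc fun x hx ↦ ?_
    refine hsc x x.2 fun v hv ↦ ?_
    rw [← Submodule.inner_orthogonalProjectionOnto_eq_of_mem_right]
    exact (Submodule.mem_orthogonal _ x).mp hx _ (Submodule.subset_span ⟨v, hv, rfl⟩)
  obtain ⟨s, hs, hu⟩ := h.exists_norm_sq_le hT hα
  by_cases hex : ∃ x ∈ M, x ≠ 0 ∧ ∀ v ∈ s, ⟪v, x⟫_ℂ = 0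
  · obtain ⟨x, hxM, hx0, hxs⟩ := hex
    have h1 := hu x hxs
    have hx : 0 < ‖x‖ := norm_pos_iff.mpr hx0
    have h2 : minModulus S ^ 2 * ‖x‖ ^ 2 ≤ ‖T x‖ ^ 2 := minModulus_sq_mul_le S ⟨x, hxM⟩
    have h3 : minModulus S ^ 2 ≤ α ^ 2 := le_of_mul_le_mul_right (h2.trans h1) (by positivity)
    rcases h3.eq_or_lt with h4 | h4
    · have h5 : ‖T x‖ = minModulus S * ‖x‖ := by
        rw [← sq_eq_sq₀ (norm_nonneg _) (mul_nonneg (minModulus_nonneg S) hx.le), mul_pow]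
        exact le_antisymm (h4 ▸ h1) h2
      refine ⟨((‖x‖⁻¹ : ℝ) : ℂ) • ⟨x, hxM⟩, ?_, ?_⟩
      · rw [norm_smul]; simp [hx.ne']
      · rw [map_smul, norm_smul]
        change _ * ‖T x‖ = _
        rw [h5]
        simp
        field_simp
    · obtain ⟨c, hc1, hc2⟩ := exists_between h4
      obtain ⟨t, ht, hb⟩ := h.exists_le_norm_sq hT hα hc2
      exact key t ht c hc1 fun x _ hx ↦ hb x hx
  · push Not at hex
    -- Here only `0` in `M` is orthogonal to `s`, so any constant above `m ^ 2` serves.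
    refine key s hs _ (lt_add_one _) fun x hx hxs ↦ ?_
    by_cases hx0 : x = 0
    · simp [hx0]
    · obtain ⟨v, hv, hvx⟩ := hex x hx hx0
      exact absurd (hxs v hv) hvx

end IsEssentiallyScalarFromBelow

end EssentiallyScalar

/-! ### Diagonalizing an absolutely minimum attaining operator. -/

section Diagonalization

variable {H : Type*} [NormedAddCommGroup H] [InnerProductSpace ℂ H] [CompleteSpace H]

namespace IsAbsMinAttaining

/-- A minimizer on a nonzero closed subspace together with its first order condition. -/
theorem exists_minimizer {T : H →L[ℂ] H} (hT : IsAbsMinAttaining T) (M : Submodule ℂ H)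
    (hM : IsClosed (M : Set H)) (hM0 : M ≠ ⊥) :
    ∃ x ∈ M, ∃ m : ℝ, 0 ≤ m ∧ ‖x‖ = 1 ∧ ‖T x‖ = m ∧ (∀ y ∈ M, m ^ 2 * ‖y‖ ^ 2 ≤ ‖T y‖ ^ 2) ∧
      ∀ y ∈ M, ⟪T y, T x⟫_ℂ = (m ^ 2 : ℝ) * ⟪y, x⟫_ℂ := by
  have : CompleteSpace M := hM.completeSpace_coe
  obtain ⟨x, hx, hTx⟩ := hT M hM hM0
  exact ⟨x, x.2, _, minModulus_nonneg _, hx, hTx, fun y hy ↦ minModulus_sq_mul_le _ (⟨y, hy⟩ : M),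
    fun y hy ↦ inner_map_map_eq_of_norm_eq_minModulus hx hTx ⟨y, hy⟩⟩

/-- If the vectors `g i` diagonalize the form `⟪T x, T y⟫` with respect to `⟪x, y⟫`, then the
corresponding diagonal values have a least element. -/
theorem exists_forall_le {T : H →L[ℂ] H} (hT : IsAbsMinAttaining T) {ι : Type*} [Nonempty ι]
    {g : ι → H} (hg : ∀ i, g i ≠ 0) {a : ι → ℝ}
    (ha : ∀ i j, ⟪T (g i), T (g j)⟫_ℂ = a i * ⟪g i, g j⟫_ℂ) : ∃ i, ∀ j, a i ≤ a j := by
  set M := (Submodule.span ℂ (Set.range g)).topologicalClosure with hM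
  have hgM : ∀ i, g i ∈ M := fun i ↦
    Submodule.le_topologicalClosure _ (Submodule.subset_span ⟨i, rfl⟩)
  have hM0 : M ≠ ⊥ := fun h ↦ by
    obtain ⟨i⟩ := ‹Nonempty ι›
    exact hg i ((Submodule.mem_bot ℂ).mp (h ▸ hgM i))
  obtain ⟨x, hxM, m, -, hx1, -, hle, hfo⟩ :=
    hT.exists_minimizer M (Submodule.isClosed_topologicalClosure _) hM0
  have hma : ∀ i, m ^ 2 ≤ a i := fun i ↦ by
    have h1 := hle _ (hgM i)
    have h2 : ‖T (g i)‖ ^ 2 = a i * ‖g i‖ ^ 2 := by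
      have := congrArg Complex.re (ha i i)
      rwa [Complex.re_ofReal_mul, ← RCLike.re_eq_complex_re, inner_self_eq_norm_sq,
        inner_self_eq_norm_sq] at this
    rw [h2] at h1
    exact le_of_mul_le_mul_right h1 (pow_pos (norm_pos_iff.mpr (hg i)) 2)
  -- Without a least value, every `a i` exceeds `m ^ 2`; the first order condition then makes the
  -- minimizer orthogonal to all `g i`, hence to itself.
  by_contra! hcon
  have hlt : ∀ i, m ^ 2 < a i := fun i ↦ by
    obtain ⟨j, hj⟩ := hcon i
    exact (hma j).trans_lt hj
  have hcl : ∀ i, ∀ y ∈ M, ⟪T (g i), T y⟫_ℂ = a i * ⟪g i, y⟫_ℂ := by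
    intro i y hy
    have hsub : M ≤ LinearMap.ker ((innerSL ℂ (T (g i)) ∘L T - (a i : ℂ) • innerSL ℂ (g i) :
        H →L[ℂ] ℂ) : H →ₗ[ℂ] ℂ) := by
      refine Submodule.topologicalClosure_minimal _ ?_ (ContinuousLinearMap.isClosed_ker _)
      rw [Submodule.span_le]
      rintro - ⟨j, rfl⟩
      simp [ha i j]
    have := hsub hy
    simpa [sub_eq_zero] using this
  have horth : ∀ i, ⟪g i, x⟫_ℂ = 0 := fun i ↦ by
    have h1 := hfo _ (hgM i)
    rw [hcl i x hxM] at h1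
    by_contra hne
    exact (hlt i).ne' (by exact_mod_cast mul_right_cancel₀ hne h1)
  have hxo : x ∈ (Submodule.span ℂ (Set.range g)).topologicalClosureᗮ := by
    rw [Submodule.orthogonal_closure, Submodule.mem_orthogonal]
    intro y hy
    induction hy using Submodule.span_induction with
    | mem y hy => obtain ⟨i, rfl⟩ := hy; exact horth i
    | zero => simp
    | add y z _ _ hy hz => rw [inner_add_left, hy, hz, add_zero]
    | smul c y _ hy => rw [inner_smul_left, hy, mul_zero]
  have hx0 : x = 0 := inner_self_eq_zero.mp ((Submodule.mem_orthogonal _ x).mp hxo x hxM)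
  simp [hx0] at hx1

/-- A minimizer on an invariant subspace satisfies `(T + m) (T - m) x = 0`, and positivity makes `T
+ m` injective when `m > 0`. -/
theorem exists_eigenvector {T : H →L[ℂ] H} (hT : IsAbsMinAttaining T) (hpos : T.IsPositive)
    (M : Submodule ℂ H) (hM : IsClosed (M : Set H)) (hM0 : M ≠ ⊥) (hMT : ∀ x ∈ M, T x ∈ M) :
    ∃ x ∈ M, ‖x‖ = 1 ∧ ∃ r : ℝ, T x = (r : ℂ) • x := by
  obtain ⟨x, hxM, m, hm, hx1, hTx, -, hfo⟩ := hT.exists_minimizer M hM hM0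
  refine ⟨x, hxM, hx1, m, ?_⟩
  have hTT : T (T x) = ((m ^ 2 : ℝ) : ℂ) • x := by
    set y := T (T x) - ((m ^ 2 : ℝ) : ℂ) • x with hy
    have hyM : y ∈ M := M.sub_mem (hMT _ (hMT _ hxM)) (M.smul_mem _ hxM)
    have h1 := hfo y hyM
    rw [hpos.isSymmetric.apply_clm, ← sub_eq_zero, ← inner_smul_right, ← inner_sub_right, ← hy,
      inner_self_eq_zero] at h1
    exact sub_eq_zero.mp h1
  rcases hm.eq_or_lt with rfl | hm
  · simpa using hTx
  set z := T x - (m : ℂ) • x with hz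
  have hTz : T z = -(m : ℂ) • z := by
    rw [hz, map_sub, map_smul, hTT, smul_sub, smul_smul]
    push_cast
    module
  have h1 := hpos.re_inner_nonneg_left z
  have h2 : 0 ≤ -m * ‖z‖ ^ 2 := by
    rwa [hTz, ← Complex.ofReal_neg, inner_smul_left, Complex.conj_ofReal, RCLike.re_eq_complex_re,
      Complex.re_ofReal_mul, ← RCLike.re_eq_complex_re, inner_self_eq_norm_sq] at h1
  have h3 : ‖z‖ ^ 2 ≤ 0 := by nlinarith
  have h4 : z = 0 := by simpa using le_antisymm h3 (sq_nonneg _)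
  exact sub_eq_zero.mp h4

/-- A positive absolutely minimum attaining operator is diagonalizable. -/
theorem exists_hilbertBasis {T : H →L[ℂ] H} (hT : IsAbsMinAttaining T) (hpos : T.IsPositive) :
    ∃ (v : Set H) (b : HilbertBasis v ℂ H) (r : v → ℝ), ∀ i, T (b i) = (r i : ℂ) • b i := by
  obtain ⟨v, hv⟩ := zorn_subset
    {v : Set H | Orthonormal ℂ (Subtype.val : v → H) ∧ ∀ x ∈ v, ∃ r : ℝ, T x = (r : ℂ) • x}
    fun c hc hch ↦ ⟨⋃₀ c, ⟨orthonormal_sUnion_of_directed hch.directedOn fun x hx ↦ (hc hx).1,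
      fun x ⟨s, hs, hxs⟩ ↦ (hc hs).2 x hxs⟩, fun _ ↦ Set.subset_sUnion_of_mem⟩
  obtain ⟨hon, heig⟩ := hv.prop
  -- The complement of a set of eigenvectors is invariant; if nonzero, it would supply an
  -- eigenvector contradicting maximality.
  have hbot : (Submodule.span ℂ (Set.range (Subtype.val : v → H)))ᗮ = ⊥ := by
    by_contra hne
    rw [Subtype.range_coe] at hne
    have hperp : ∀ x, x ∈ (Submodule.span ℂ v)ᗮ ↔ ∀ y ∈ v, ⟪y, x⟫_ℂ = 0 := fun x ↦ by
      rw [Submodule.mem_orthogonal]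
      refine ⟨fun h y hy ↦ h y (Submodule.subset_span hy), fun h y hy ↦ ?_⟩
      induction hy using Submodule.span_induction with
      | mem y hy => exact h y hy
      | zero => simp
      | add y z _ _ hy hz => rw [inner_add_left, hy, hz, add_zero]
      | smul c y _ hy => rw [inner_smul_left, hy, mul_zero]
    obtain ⟨x, hxM, hx1, hxr⟩ := hT.exists_eigenvector hpos _
      (Submodule.isClosed_orthogonal _) hne fun x hx ↦ by
        rw [hperp] at hx ⊢
        intro y hy
        obtain ⟨r, hr⟩ := heig y hy
        rw [← hpos.isSymmetric.apply_clm, hr, inner_smul_left, hx y hy, mul_zero]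
    rw [hperp] at hxM
    classical
    have hins : Orthonormal ℂ (Subtype.val : ↥(insert x v) → H) := by
      rw [orthonormal_subtype_iff_ite] at hon ⊢
      have h0 : ∀ y ∈ v, ⟪x, y⟫_ℂ = 0 := fun y hy ↦ inner_eq_zero_symm.mp (hxM y hy)
      have hxx : ⟪x, x⟫_ℂ = 1 := by rw [inner_self_eq_norm_sq_to_K, hx1]; simp
      have hxv : x ∉ v := fun h ↦ one_ne_zero (hxx.symm.trans (h0 x h))
      rintro y (rfl | hy) z (rfl | hz)
      · simpa using hxx
      · rw [h0 z hz, if_neg]; rintro rfl; exact hxv hz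
      · rw [hxM y hy, if_neg]; rintro rfl; exact hxv hy
      · exact hon y hy z hz
    have hxv : x ∈ v := hv.le_of_ge ⟨hins, by
      rintro y (rfl | hy)
      · exact hxr
      · exact heig y hy⟩ (Set.subset_insert x v) (Set.mem_insert x v)
    have := hxM x hxv
    rw [inner_self_eq_zero] at this
    simp [this] at hx1
  choose r hr using fun i : v ↦ heig i i.2
  exact ⟨v, HilbertBasis.mkOfOrthogonalEqBot hon hbot, r, fun i ↦ by
    simpa only [HilbertBasis.coe_mkOfOrthogonalEqBot] using hr i⟩

end IsAbsMinAttaining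

end Diagonalization

/-! ### Distribution of the eigenvalues, and the cone. -/

section Spectrum

variable {H : Type*} [NormedAddCommGroup H] [InnerProductSpace ℂ H] [CompleteSpace H]

namespace IsAbsMinAttaining

/-- The eigenvalues cannot accumulate on both sides of a gap: mixing eigenvectors of both groups
would produce a family with strictly decreasing diagonal values. -/
theorem finite_lt_or_finite_gt {T : H →L[ℂ] H} (hT : IsAbsMinAttaining T) {ι : Type*}
    {b : ι → H} (hb : Orthonormal ℂ b) {r : ι → ℝ} (hr : ∀ i, T (b i) = (r i : ℂ) • b i)
    (hr0 : ∀ i, 0 ≤ r i) {p q : ℝ} (hpq : p < q) :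
    {i | r i < p}.Finite ∨ {i | q < r i}.Finite := by
  by_contra! hcon
  obtain ⟨hP, hQ⟩ := hcon
  set e := Set.Infinite.natEmbedding _ hP
  set f := Set.Infinite.natEmbedding _ hQ
  have he : ∀ n, r (e n) < p := fun n ↦ (e n).2
  have hf : ∀ n, q < r (f n) := fun n ↦ (f n).2
  have hp : 0 < p := (hr0 _).trans_lt (he 0)
  have hpq2 : p ^ 2 < q ^ 2 := pow_lt_pow_left₀ hpq hp.le two_ne_zero
  -- Values decreasing strictly from `q ^ 2` towards `p ^ 2`. The weights `c n ^ 2`, `s n ^ 2` below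
  -- make `t n` the weighted mean of `r (e n) ^ 2` and `r (f n) ^ 2`.
  set t : ℕ → ℝ := fun n ↦ p ^ 2 + (q ^ 2 - p ^ 2) / (n + 1) with ht
  have ht1 : ∀ n, p ^ 2 < t n := fun n ↦ by
    have : 0 < (q ^ 2 - p ^ 2) / (n + 1 : ℝ) := div_pos (sub_pos.mpr hpq2) (by positivity)
    simp only [ht]; linarith
  have ht2 : ∀ n, t n ≤ q ^ 2 := fun n ↦ by
    have : (q ^ 2 - p ^ 2) / (n + 1 : ℝ) ≤ q ^ 2 - p ^ 2 :=
      div_le_self (sub_pos.mpr hpq2).le (by linarith [(Nat.cast_nonneg n : (0 : ℝ) ≤ n)])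
    simp only [ht]; linarith
  have hlo : ∀ n, 0 < t n - r (e n) ^ 2 := fun n ↦ by
    have := pow_lt_pow_left₀ (he n) (hr0 _) two_ne_zero
    linarith [ht1 n]
  have hhi : ∀ n, 0 < r (f n) ^ 2 - t n := fun n ↦ by
    have := pow_lt_pow_left₀ (hf n) (hp.trans hpq).le two_ne_zero
    linarith [ht2 n]
  set c : ℕ → ℝ := fun n ↦ √(r (f n) ^ 2 - t n) with hc
  set s : ℕ → ℝ := fun n ↦ √(t n - r (e n) ^ 2) with hs
  have hc2 : ∀ n, c n ^ 2 = r (f n) ^ 2 - t n := fun n ↦ Real.sq_sqrt (hhi n).le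
  have hs2 : ∀ n, s n ^ 2 = t n - r (e n) ^ 2 := fun n ↦ Real.sq_sqrt (hlo n).le
  have hbal : ∀ n, c n ^ 2 * r (e n) ^ 2 + s n ^ 2 * r (f n) ^ 2 = t n * (c n ^ 2 + s n ^ 2) :=
    fun n ↦ by rw [hc2, hs2]; ring
  have hef : ∀ n k, (e n : ι) ≠ f k := fun n k h ↦ by
    have h1 := he n
    rw [h] at h1
    linarith [hf k]
  have hee : ∀ n k, n ≠ k → (e n : ι) ≠ e k := fun n k h h' ↦ h (e.injective (Subtype.ext h'))
  have hff : ∀ n k, n ≠ k → (f n : ι) ≠ f k := fun n k h h' ↦ h (f.injective (Subtype.ext h'))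
  have hb1 : ∀ i, ⟪b i, b i⟫_ℂ = 1 := fun i ↦ by
    rw [inner_self_eq_norm_sq_to_K, hb.1 i]; simp
  have hb0 : ∀ i j, i ≠ j → ⟪b i, b j⟫_ℂ = 0 := fun i j h ↦ hb.2 h
  have hg : ∀ n, (c n : ℂ) • b (e n) + (s n : ℂ) • b (f n) ≠ 0 := fun n h ↦ by
    have h1 := congrArg (fun x ↦ ⟪b (e n), x⟫_ℂ) h
    simp only [inner_add_right, inner_smul_right, hb1, hb0 _ _ (hef n n), inner_zero_right,
      mul_zero, add_zero, mul_one, Complex.ofReal_eq_zero] at h1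
    exact (Real.sqrt_pos.mpr (hhi n)).ne' h1
  obtain ⟨n, hn⟩ := hT.exists_forall_le hg (a := t) fun n k ↦ by
    simp only [map_add, map_smul, hr, inner_add_left, inner_add_right, inner_smul_left,
      inner_smul_right, Complex.conj_ofReal, hb0 _ _ (hef _ _), hb0 _ _ (hef _ _).symm]
    rcases eq_or_ne n k with rfl | hnk
    · simp only [hb1]
      have := congrArg (Complex.ofReal) (hbal n)
      push_cast at this
      linear_combination this
    · simp [hb0 _ _ (hee n k hnk), hb0 _ _ (hff n k hnk)]
  have h1 := hn (n + 1)
  have h2 : (q ^ 2 - p ^ 2) / ((n + 1 : ℕ) + 1 : ℝ) < (q ^ 2 - p ^ 2) / (n + 1 : ℝ) :=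
    div_lt_div_of_pos_left (sub_pos.mpr hpq2) (by positivity) (by push_cast; linarith)
  simp only [ht] at h1
  linarith

theorem exists_isEssentiallyScalarFromBelow {T : H →L[ℂ] H} (hT : IsAbsMinAttaining T)
    (hpos : T.IsPositive) : ∃ α : ℝ, 0 ≤ α ∧ IsEssentiallyScalarFromBelow T α := by
  obtain ⟨v, b, r, hr⟩ := hT.exists_hilbertBasis hpos
  have hbn : ∀ i, ‖b i‖ = 1 := b.orthonormal.1
  have hr0 : ∀ i, 0 ≤ r i := fun i ↦ by
    have h := hpos.re_inner_nonneg_right (b i)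
    rw [hr, inner_smul_right, inner_self_eq_norm_sq_to_K, hbn] at h
    simpa using h
  have hrT : ∀ i, r i ≤ ‖T‖ := fun i ↦ by
    have h := T.le_opNorm (b i)
    rwa [hr, norm_smul, hbn, mul_one, mul_one, Complex.norm_real,
      Real.norm_of_nonneg (hr0 i)] at h
  obtain ⟨α, hα0, hα⟩ : ∃ α : ℝ, 0 ≤ α ∧ Tendsto r cofinite (𝓝 α) := by
    rcases (cofinite : Filter v).eq_or_neBot with h | h
    -- For a finite index set convergence is vacuous, so any `α ≥ 0` would do.
    · exact ⟨0, le_rfl, h ▸ tendsto_bot⟩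
    obtain ⟨α, hα⟩ : ∃ α : ℝ, Tendsto r cofinite (𝓝 α) := by
      refine tendsto_of_no_upcrossings dense_univ ?_
        (isBoundedUnder_of ⟨‖T‖, hrT⟩) (isBoundedUnder_of ⟨0, hr0⟩)
      rintro p - q - hpq ⟨h1, h2⟩
      rw [frequently_cofinite_iff_infinite] at h1 h2
      exact (hT.finite_lt_or_finite_gt b.orthonormal hr hr0 hpq).elim h1 h2
    exact ⟨α, ge_of_tendsto' hα hr0, hα⟩
  -- Infinitely many eigenvalues above `α` would have a least one, but only finitely many can reach
  -- it, as `r` tends to `α`.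
  have hfin : {i | α < r i}.Finite := by
    by_contra hinf
    have : Nonempty {i | α < r i} := (Set.Infinite.nonempty hinf).to_subtype
    obtain ⟨i, hi⟩ := hT.exists_forall_le (g := fun i : {i | α < r i} ↦ b i)
      (a := fun i ↦ r i ^ 2) (fun i h ↦ by simpa [h] using hbn i) fun i j ↦ by
        rcases eq_or_ne i j with rfl | hij
        · simp only [hr, inner_smul_left, inner_smul_right, Complex.conj_ofReal]
          push_cast
          ring
        · have h0 : ⟪b i, b j⟫_ℂ = 0 := b.orthonormal.2 fun h ↦ hij (Subtype.ext h)
          simp only [hr, inner_smul_left, inner_smul_right, h0, mul_zero]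
    have hev := hα.eventually_lt_const i.2
    refine hinf ((eventually_cofinite.mp hev).subset fun j hj ↦ ?_)
    rw [Set.mem_ofPred_eq, not_lt]
    exact le_of_sq_le_sq (hi ⟨j, hj⟩) (hr0 j)
  have hform : ∀ x, HasSum (fun i ↦ r i * ‖⟪b i, x⟫_ℂ‖ ^ 2) (⟪T x, x⟫_ℂ).re := fun x ↦ by
    have h := Complex.hasSum_re (b.hasSum_inner_mul_inner (T x) x)
    convert h using 2 with i
    rw [hpos.isSymmetric.apply_clm, hr, inner_smul_right, mul_assoc,
      ← inner_conj_symm x (b i), Complex.conj_mul', Complex.re_ofReal_mul]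
    norm_cast
  have hnorm : ∀ x, HasSum (fun i ↦ ‖⟪b i, x⟫_ℂ‖ ^ 2) (‖x‖ ^ 2) := fun x ↦ by
    have h := Complex.hasSum_re (b.hasSum_inner_mul_inner x x)
    convert h using 2 with i
    · rw [← inner_conj_symm x (b i), Complex.conj_mul']
      norm_cast
    · rw [inner_self_eq_norm_sq_to_K]
      norm_cast
  -- Orthogonality to the finitely many exceptional basis vectors kills the bad terms; the rest
  -- compare termwise.
  refine ⟨α, hα0, ⟨b '' {i | α < r i}, hfin.image b, fun x hx ↦ ?_⟩, fun ε hε ↦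
    ⟨b '' {i | ¬ α - ε < r i}, (eventually_cofinite.mp
      (hα.eventually_const_lt (sub_lt_self α hε))).image b, fun x hx ↦ ?_⟩⟩
  · refine hasSum_le (fun i ↦ ?_) (hform x) ((hnorm x).mul_left α)
    by_cases hi : α < r i
    · simp [hx _ ⟨i, hi, rfl⟩]
    · exact mul_le_mul_of_nonneg_right (not_lt.mp hi) (sq_nonneg _)
  · refine hasSum_le (fun i ↦ ?_) ((hnorm x).mul_left (α - ε)) (hform x)
    by_cases hi : α - ε < r i
    · exact mul_le_mul_of_nonneg_right hi.le (sq_nonneg _)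
    · simp [hx _ ⟨i, hi, rfl⟩]

end IsAbsMinAttaining

theorem mem_posAbsMinAttaining_iff {T : H →L[ℂ] H} :
    T ∈ posAbsMinAttaining H ↔
      T.IsPositive ∧ ∃ α : ℝ, 0 ≤ α ∧ IsEssentiallyScalarFromBelow T α :=
  ⟨fun h ↦ ⟨h.2, h.1.exists_isEssentiallyScalarFromBelow h.2⟩,
    fun ⟨hT, _, hα, h⟩ ↦ ⟨h.isAbsMinAttaining hT hα, hT⟩⟩

theorem add_mem_posAbsMinAttaining {T₁ T₂ : H →L[ℂ] H} (h₁ : T₁ ∈ posAbsMinAttaining H)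
    (h₂ : T₂ ∈ posAbsMinAttaining H) : T₁ + T₂ ∈ posAbsMinAttaining H := by
  rw [mem_posAbsMinAttaining_iff] at *
  obtain ⟨hT₁, α₁, hα₁, h₁⟩ := h₁
  obtain ⟨hT₂, α₂, hα₂, h₂⟩ := h₂
  exact ⟨hT₁.add hT₂, α₁ + α₂, add_nonneg hα₁ hα₂, h₁.add h₂⟩

theorem smul_mem_posAbsMinAttaining {T : H →L[ℂ] H} (h : T ∈ posAbsMinAttaining H) {c : ℝ}
    (hc : 0 < c) : c • T ∈ posAbsMinAttaining H := by
  rw [mem_posAbsMinAttaining_iff] at *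
  obtain ⟨hT, α, hα, h⟩ := h
  refine ⟨?_, c * α, mul_nonneg hc.le hα, h.smul hc⟩
  rw [← Complex.coe_smul]
  exact hT.smul_of_nonneg (by exact_mod_cast hc.le)

theorem zero_mem_posAbsMinAttaining : (0 : H →L[ℂ] H) ∈ posAbsMinAttaining H :=
  mem_posAbsMinAttaining_iff.mpr
    ⟨ContinuousLinearMap.isPositive_zero, 0, le_rfl, IsEssentiallyScalarFromBelow.zero⟩

end Spectrum

theorem mainTheorem10 {H : Type*} [NormedAddCommGroup H] [InnerProductSpace ℂ H]
    [CompleteSpace H] (hdim : ¬ FiniteDimensional ℂ H) :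
    (∀ T₁ ∈ posAbsMinAttaining H, ∀ T₂ ∈ posAbsMinAttaining H,
      T₁ + T₂ ∈ posAbsMinAttaining H) ∧
    ∃ C : ConvexCone ℝ (selfAdjoint (H →L[ℂ] H)),
      Subtype.val '' (C : Set (selfAdjoint (H →L[ℂ] H))) = posAbsMinAttaining H ∧
      C.Pointed ∧ C.Salient := by
  refine ⟨fun T₁ h₁ T₂ h₂ ↦ add_mem_posAbsMinAttaining h₁ h₂,
    ⟨{S | (S : H →L[ℂ] H) ∈ posAbsMinAttaining H},
      -- `ConvexCone` asks only for positive scalars; `Pointed` covers the scalar `0`.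
      fun c hc S hS ↦ smul_mem_posAbsMinAttaining hS hc,
      fun S₁ h₁ S₂ h₂ ↦ add_mem_posAbsMinAttaining h₁ h₂⟩, ?_, ?_, ?_⟩
  · ext T
    constructor
    · rintro ⟨S, hS, rfl⟩
      exact hS
    · exact fun hT ↦ ⟨⟨T, hT.2.isSelfAdjoint⟩, hT, rfl⟩
  · exact zero_mem_posAbsMinAttaining
  · intro S hS hS0 hneg
    refine hS0 (Subtype.ext (le_antisymm ?_ ?_))
    · have h : 0 ≤ -(S : H →L[ℂ] H) := (ContinuousLinearMap.nonneg_iff_isPositive _).mpr hneg.2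
      exact neg_nonneg.mp h
    · exact (ContinuousLinearMap.nonneg_iff_isPositive _).mpr hS.2
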